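/- Let $p$ be a prime. A $\beta$-set of a partition $\lambda=(\lambda_1\ge\lambda_2\ge\cdots)$ is a set $X=\{\lambda_i+k-i:1\le i\le k\}$, where $k\ge 0$ is at least the number of nonzero parts of $\lambda$; removing a $p$-hook from $\lambda$ means replacing some $x\in X$ with $x\ge p$, $x-p\notin X$ by $x-p$. The $p$-core $\lambda^0$ of $\lambda$ is the partition obtained by successively removing $p$-hooks until none is left. The $p$-quotient of $\lambda$ is $(\lambda_0,\dots,\lambda_{p-1})$, where $\lambda_\gamma$ is the partition with $\beta$-set $X_\gamma=\{j:\gamma+jp\in X\}$ and $X$ is a $\beta$-set of $\lambda$ with $|X|\equiv 0\pmod p$. For a partition $\lambda$ let $D(\lambda)$ be the set of pairs $(\alpha\,|\,\beta)$ of the leg length $\alpha$ and the arm length $\beta$ of the diagonal hooks of $\lambda$, and let $D(\lambda)_L$ and $D(\lambda)_R$ be the sets of leg lengths and of arm lengths that occur. For $0\le\gamma\le p-1$ put $$D_\gamma(\lambda)_L=\{m\ge 0:(p-1-\gamma)+mp\in D(\lambda)_L\},\qquad D_\gamma(\lambda)_R=\{m\ge 0:\gamma+mp\in D(\lambda)_R\}.$$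 Let $\lambda$ be a symmetric partition (that is, $\lambda=\lambda^*$) with $p$-core $\lambda^0$ (possibly empty), and let $\bar\lambda$ be the symmetric partition with empty $p$-core and the same $p$-quotient as $\lambda$. For $0\le\gamma\le p-1$ let $d^0_\gamma$ be the number of pairs $(\beta\,|\,\beta)\in D(\lambda^0)$ with $\beta\equiv\gamma\pmod p$. Let $\Omega'=\{\gamma: 0\le\gamma\le p-1,\ d^0_\gamma>0\}$, $(\Omega')^*=\{p-1-\gamma:\gamma\in\Omega'\}$ and $\Omega''=\{0,\dots,p-1\}\setminus(\Omega'\cup(\Omega')^*)$. For $\gamma'\in\Omega'$ put $$S_{\gamma'}=\{s\in\mathbb N: s\notin D_{\gamma'}(\bar\lambda)_L,\ 0\le s\le d^0_{\gamma'}-1\},\qquad T_{\gamma'}=\{t\in D_{\gamma'}(\bar\lambda)_L: t\ge d^0_{\gamma'}\}.$$ Then $$D(\lambda)_R=O_1\cup O_2\cup O_3\cup O_4,$$ where $$O_1=\bigcup_{\gamma'\in\Omega'}\{\gamma'+(\sigma+d^0_{\gamma'})p:\sigma\in D_{\gamma'}(\bar\lambda)_R\},\qquad O_2=\bigcup_{\gamma'\in\Omega'}\{\gamma'+(d^0_{\gamma'}-s-1)p:s\in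 S_{\gamma'}\},$$ $$O_3=\bigcup_{\gamma'\in\Omega'}\{(p-1-\gamma')+(t-d^0_{\gamma'})p:t\in T_{\gamma'}\},\qquad O_4=\bigcup_{\gamma''\in\Omega''}\{\gamma''+\mu p:\mu\in D_{\gamma''}(\bar\lambda)_R\}.$$ -/

import Mathlib

namespace DiagonalHooks

/-- The partition represented by the `β`-set `X`. A bead `x ∈ X` with `a` beads to its right and
`b` spaces to its left (among the nonnegative integers) is the row with (zero-based) index `a`,
of length `b`. As `b` weakly decreases when `a` increases, the Young diagram is the union of the
`(a + 1) × b` rectangles attached to the beads. `X` is a `β`-set of `lam` if and only if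
`ofBeta X = lam`. -/
def ofBeta (X : Finset ℕ) : YoungDiagram where
  cells := X.biUnion fun x =>
    Finset.range ((X.filter fun z => x < z).card + 1) ×ˢ
      Finset.range ((Finset.range x).filter fun y => y ∉ X).card
  isLowerSet := by
    intro c d hdc hc
    simp only [Finset.coe_biUnion, Set.mem_iUnion, Finset.mem_coe, Finset.mem_product,
      Finset.mem_range] at hc ⊢
    obtain ⟨x, hx, h1, h2⟩ := hc
    exact ⟨x, hx, lt_of_le_of_lt hdc.1 h1, lt_of_le_of_lt hdc.2 h2⟩

/-- The `β`-set of `lam` with `k` elements (for `k` at least the number of rows of `lam`):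
the numbers `lam_i + (k - i)`, `i = 1, …, k`, written with zero-based row indices. -/
def betaSet (lam : YoungDiagram) (k : ℕ) : Finset ℕ :=
  (Finset.range k).image fun i => lam.rowLen i + (k - 1 - i)

/-- The induced `β`-set on the `γ`th runner of the `p`-abacus: `X_γ = {j : γ + j p ∈ X}`. -/
def runner (p : ℕ) (X : Finset ℕ) (γ : ℕ) : Finset ℕ :=
  (X.filter fun x => x % p = γ).image fun x => x / p

/-- The `p`-quotient `(lam_0, …, lam_{p-1})`, obtained from a `β`-set of `lam` whose number of
elements is divisible by `p`. -/
def pQuotient (p : ℕ) (lam : YoungDiagram) (γ : Fin p) : YoungDiagram :=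
  ofBeta (runner p (betaSet lam (p * lam.colLen 0)) γ)

/-- `mu` is obtained from `lam` by removing one `p`-hook: in some `β`-set `X` of `lam` a bead `x`
is moved to the space `x - p`. -/
def RemovesPHook (p : ℕ) (lam mu : YoungDiagram) : Prop :=
  ∃ (X : Finset ℕ) (x : ℕ), ofBeta X = lam ∧ x ∈ X ∧ p ≤ x ∧ x - p ∉ X ∧
    ofBeta (insert (x - p) (X.erase x)) = mu

/-- `core` is the `p`-core of `lam`: it is reached from `lam` by successively removing `p`-hooks,
and no `p`-hook can be removed from it. -/
def IsPCoreOf (p : ℕ) (core lam : YoungDiagram) : Prop :=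
  Relation.ReflTransGen (RemovesPHook p) lam core ∧ ∀ mu, ¬ RemovesPHook p core mu

/-- A partition is symmetric if it equals its dual. -/
def IsSymmetric (lam : YoungDiagram) : Prop := lam.transpose = lam

/-- `bar` is the symmetric partition with empty `p`-core that has the same `p`-quotient as
`lam`. -/
structure IsBarOf (p : ℕ) (bar lam : YoungDiagram) : Prop where
  symmetric : IsSymmetric bar
  core_empty : IsPCoreOf p ⊥ bar
  quotient_eq : pQuotient p bar = pQuotient p lam

/-- The bisequence `D(lam)`, as the set of pairs (leg length, arm length) of the diagonal hooks
of `lam`. -/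
def D (lam : YoungDiagram) : Finset (ℕ × ℕ) :=
  (lam.cells.filter fun c => c.1 = c.2).image fun c =>
    (lam.colLen c.2 - c.1 - 1, lam.rowLen c.1 - c.2 - 1)

/-- `D(lam)_L`: the leg lengths of the diagonal hooks. -/
def DL (lam : YoungDiagram) : Finset ℕ := (D lam).image Prod.fst

/-- `D(lam)_R`: the arm lengths of the diagonal hooks. -/
def DR (lam : YoungDiagram) : Finset ℕ := (D lam).image Prod.snd

/-- `D_γ(lam)_L`, the left part of the `γ`th component of the `p`-quotient of `D(lam)`:
all `m` such that `(p - 1 - γ) + m p ∈ D(lam)_L` (for `0 ≤ γ ≤ p - 1`). -/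
def quotL (p : ℕ) (lam : YoungDiagram) (γ : ℕ) : Finset ℕ :=
  ((DL lam).filter fun α => α % p = p - 1 - γ).image fun α => α / p

/-- `D_γ(lam)_R`, the right part of the `γ`th component of the `p`-quotient of `D(lam)`:
all `m` such that `γ + m p ∈ D(lam)_R` (for `0 ≤ γ ≤ p - 1`). -/
def quotR (p : ℕ) (lam : YoungDiagram) (γ : ℕ) : Finset ℕ :=
  ((DR lam).filter fun β => β % p = γ).image fun β => β / p

/-- `D(lam)_γ`: the set of `(β | β) ∈ D(lam)` with `β ≡ γ` modulo `p` (for `0 ≤ γ ≤ p - 1`). -/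
def residuePart (p : ℕ) (lam : YoungDiagram) (γ : ℕ) : Finset (ℕ × ℕ) :=
  (D lam).filter fun a => a.1 = a.2 ∧ a.2 % p = γ

/-- `d⁰_γ = |D(core)_γ|`. -/
def d0 (p : ℕ) (core : YoungDiagram) (γ : ℕ) : ℕ := (residuePart p core γ).card

/-- `Ω'`: the residues `γ` with `d⁰_γ > 0`. -/
def Omega' (p : ℕ) (core : YoungDiagram) : Finset ℕ :=
  (Finset.range p).filter fun γ => 0 < d0 p core γ

/-- `(Ω')* = {p - 1 - γ : γ ∈ Ω'}`. -/
def Omega'Star (p : ℕ) (core : YoungDiagram) : Finset ℕ :=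
  (Omega' p core).image fun γ => p - 1 - γ

/-- `Ω''`: the residues that lie neither in `Ω'` nor in `(Ω')*`. -/
def Omega'' (p : ℕ) (core : YoungDiagram) : Finset ℕ :=
  Finset.range p \ (Omega' p core ∪ Omega'Star p core)

/-- `S_γ = {s : s ∉ D_γ(bar)_L, 0 ≤ s ≤ d⁰_γ - 1}`. -/
def S (p : ℕ) (core bar : YoungDiagram) (γ : ℕ) : Finset ℕ :=
  (Finset.range (d0 p core γ)).filter fun s => s ∉ quotL p bar γ

/-- `T_γ = {t : t ∈ D_γ(bar)_L, t ≥ d⁰_γ}`. -/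
def T (p : ℕ) (core bar : YoungDiagram) (γ : ℕ) : Finset ℕ :=
  (quotL p bar γ).filter fun t => d0 p core γ ≤ t

/-- The union over `γ ∈ Ω'` of `{γ + (σ + d⁰_γ) p : σ ∈ D_γ(bar)_R}`. -/
def O1 (p : ℕ) (core bar : YoungDiagram) : Finset ℕ :=
  (Omega' p core).biUnion fun γ =>
    (quotR p bar γ).image fun σ => γ + (σ + d0 p core γ) * p

/-- The union over `γ ∈ Ω'` of `{γ + (d⁰_γ - s - 1) p : s ∈ S_γ}`. -/
def O2 (p : ℕ) (core bar : YoungDiagram) : Finset ℕ :=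
  (Omega' p core).biUnion fun γ =>
    (S p core bar γ).image fun s => γ + (d0 p core γ - s - 1) * p

/-- The union over `γ ∈ Ω'` of `{(p - 1 - γ) + (t - d⁰_γ) p : t ∈ T_γ}`. -/
def O3 (p : ℕ) (core bar : YoungDiagram) : Finset ℕ :=
  (Omega' p core).biUnion fun γ =>
    (T p core bar γ).image fun t => (p - 1 - γ) + (t - d0 p core γ) * p

/-- The union over `γ ∈ Ω''` of `{γ + μ p : μ ∈ D_γ(bar)_R}`. -/
def O4 (p : ℕ) (core bar : YoungDiagram) : Finset ℕ :=
  (Omega'' p core).biUnion fun γ =>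
    (quotR p bar γ).image fun μ => γ + μ * p

end DiagonalHooks

namespace DiagonalHooks

/-! Encode `lam` by its Maya diagram M, the set of all `lam_i - i - 1`. Its nonnegative elements are
the arm lengths of the diagonal hooks (`mem_DR`), and duality replaces M by its complement reflected
in z ↦ -1 - z (`mem_maya_transpose`). Split M into p runners by residue and let c_γ be the charge of
runner γ. Removing a p-hook pushes one bead one step down its runner and preserves every charge, so
runner γ of the core is the ray below c_γ (`IsPCoreOf.mayaRunner_eq`). By symmetry c_{p-1-γ} = -c_γ,
and d⁰_γ = max(c_γ, 0) (`d0_eq`). The quotient records each runner up to a shift by its charge. The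
charges of `bar` all vanish, so γ + mp lies in D(lam)_R exactly when m - c_γ lies on runner γ of
`bar` (`IsBarOf.add_mul_mem_DR_iff`). For c_γ > 0 this gives O₁ when m ≥ c_γ and, after reflecting a
negative position, O₂ when m < c_γ; c_γ < 0 gives O₃ with γ' = p - 1 - γ, and c_γ = 0 gives O₄. -/

/-- The Maya diagram of `lam`: the set of all `lam_i - i - 1` with zero-based `i`. -/
def maya (lam : YoungDiagram) : Set ℤ :=
  Set.range fun i : ℕ => (lam.rowLen i : ℤ) - i - 1

/-- The set of integers obtained from the `β`-set `X` by filling all negative positions with beads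
and shifting by `k` to the left. -/
def beads (X : Finset ℕ) (k : ℕ) : Set ℤ :=
  {z | z + k < 0 ∨ ∃ x ∈ X, z + k = (x : ℤ)}

/-- The `γ`th runner of the Maya diagram of `lam` on the `p`-abacus. -/
def mayaRunner (p : ℕ) (lam : YoungDiagram) (γ : ℕ) : Set ℤ :=
  {j | (γ : ℤ) + j * p ∈ maya lam}

/-- The number of nonnegative beads minus the number of negative spaces. -/
noncomputable def charge (N : Set ℤ) : ℤ :=
  ((N ∩ Set.Ici 0).ncard : ℤ) - (Set.Iio 0 \ N).ncard

/-! ### Maya diagrams and β-sets -/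

theorem mem_maya {lam : YoungDiagram} {z : ℤ} :
    z ∈ maya lam ↔ ∃ i : ℕ, (lam.rowLen i : ℤ) - i - 1 = z := Iff.rfl

theorem mem_beads {X : Finset ℕ} {k : ℕ} {z : ℤ} :
    z ∈ beads X k ↔ z + k < 0 ∨ ∃ x ∈ X, z + k = (x : ℤ) := Iff.rfl

theorem mem_mayaRunner {p : ℕ} {lam : YoungDiagram} {γ : ℕ} {j : ℤ} :
    j ∈ mayaRunner p lam γ ↔ (γ : ℤ) + j * p ∈ maya lam := Iff.rfl

/-- The sequence `lam_i - i - 1` is strictly decreasing, so its range determines it. -/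
theorem maya_injective : Function.Injective maya := by
  have anti (lam : YoungDiagram) :
      StrictAnti fun i : ℕ => (lam.rowLen i : ℤ) - i - 1 := by
    refine strictAnti_nat_of_succ_lt fun n => ?_
    have := lam.rowLen_anti n (n + 1) (by omega)
    push_cast
    omega
  intro a b h
  have h' : StrictMono fun i : ℕ => -((a.rowLen i : ℤ) - i - 1) := (anti a).neg
  have h'' : StrictMono fun i : ℕ => -((b.rowLen i : ℤ) - i - 1) := (anti b).neg
  have hr := (h'.range_inj h'').1 (by
    have := congrArg (fun s => Neg.neg '' s) h
    simpa [maya, ← Set.range_comp, Function.comp_def] using this)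
  ext ⟨i, j⟩
  have hi := congrFun hr i
  have hi' : a.rowLen i = b.rowLen i := by omega
  simp only [YoungDiagram.mem_cells, YoungDiagram.mem_iff_lt_rowLen, hi']

theorem rowLen_eq_zero {lam : YoungDiagram} {k i : ℕ} (hk : lam.colLen 0 ≤ k) (hi : k ≤ i) :
    lam.rowLen i = 0 := by
  by_contra h
  have h1 : (i, 0) ∈ lam := YoungDiagram.mem_iff_lt_rowLen.2 (by omega)
  have h2 := YoungDiagram.mem_iff_lt_colLen.1 h1
  omega

theorem maya_eq_beads_betaSet (lam : YoungDiagram) {k : ℕ} (hk : lam.colLen 0 ≤ k) :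
    maya lam = beads (betaSet lam k) k := by
  ext z
  simp only [mem_maya, mem_beads, betaSet, Finset.mem_image, Finset.mem_range]
  constructor
  · rintro ⟨i, rfl⟩
    by_cases hi : i < k
    · exact .inr ⟨_, ⟨i, hi, rfl⟩, by omega⟩
    · rw [rowLen_eq_zero hk (by omega : k ≤ i)]
      left
      omega
  · rintro (h | ⟨x, ⟨i, hi, rfl⟩, h⟩)
    · refine ⟨(-z - 1).toNat, ?_⟩
      rw [rowLen_eq_zero hk (by omega)]
      omega
    · exact ⟨i, by omega⟩

theorem card_betaSet (lam : YoungDiagram) (k : ℕ) : (betaSet lam k).card = k := by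
  rw [betaSet, Finset.card_image_of_injOn, Finset.card_range]
  intro i hi j hj h
  simp only [Finset.coe_range, Set.mem_Iio] at hi hj h
  rcases lt_trichotomy i j with hij | hij | hij
  · have := lam.rowLen_anti i j hij.le
    omega
  · exact hij
  · have := lam.rowLen_anti j i hij.le
    omega

theorem mem_ofBeta {X : Finset ℕ} {i j : ℕ} :
    (i, j) ∈ ofBeta X ↔ ∃ x ∈ X, i ≤ (X.filter fun z => x < z).card ∧
      j < ((Finset.range x).filter fun y => y ∉ X).card := by
  rw [← YoungDiagram.mem_cells]
  simp [ofBeta]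

theorem card_filter_gt_strictAnti {X : Finset ℕ} {x y : ℕ} (hy : y ∈ X) (h : x < y) :
    (X.filter fun z => y < z).card < (X.filter fun z => x < z).card := by
  refine Finset.card_lt_card ⟨fun z hz => ?_, fun hs => ?_⟩
  · simp only [Finset.mem_filter] at hz ⊢
    exact ⟨hz.1, by omega⟩
  · simpa using hs (show y ∈ X.filter fun z => x < z by simp [hy, h])

theorem card_filter_gt_lt {X : Finset ℕ} {x : ℕ} (hx : x ∈ X) :
    (X.filter fun z => x < z).card < X.card :=
  Finset.card_lt_card ⟨Finset.filter_subset _ _, fun hs => by simpa using hs hx⟩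

theorem exists_card_filter_gt_eq {X : Finset ℕ} {i : ℕ} (hi : i < X.card) :
    ∃ x ∈ X, (X.filter fun z => x < z).card = i := by
  have := Finset.surjOn_of_injOn_of_card_le (s := X) (t := Finset.range X.card)
    (fun x => (X.filter fun z => x < z).card)
    (fun x hx => by simpa using card_filter_gt_lt hx)
    (fun x hx y hy h => by
      simp only at h
      rcases lt_trichotomy x y with hxy | hxy | hxy
      · have := card_filter_gt_strictAnti hy hxy
        omega
      · exact hxy
      · have := card_filter_gt_strictAnti hx hxy
        omega)
    (by simp)
  obtain ⟨x, hx, h⟩ := this (show i ∈ (Finset.range X.card : Set ℕ) by simpa using hi)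
  exact ⟨x, hx, h⟩

theorem rowLen_ofBeta {X : Finset ℕ} {x : ℕ} (hx : x ∈ X) :
    (ofBeta X).rowLen (X.filter fun z => x < z).card =
      ((Finset.range x).filter fun y => y ∉ X).card := by
  refine eq_of_forall_lt_iff fun j => ?_
  rw [← YoungDiagram.mem_iff_lt_rowLen, mem_ofBeta]
  constructor
  · rintro ⟨y, hy, h1, h2⟩
    have hyx : y ≤ x := by
      by_contra h
      have := card_filter_gt_strictAnti hy (not_le.1 h)
      omega
    refine h2.trans_le (Finset.card_le_card fun z hz => ?_)
    simp only [Finset.mem_filter, Finset.mem_range] at hz ⊢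
    exact ⟨by omega, hz.2⟩
  · exact fun h => ⟨x, hx, le_rfl, h⟩

theorem rowLen_ofBeta_of_card_le {X : Finset ℕ} {i : ℕ} (hi : X.card ≤ i) :
    (ofBeta X).rowLen i = 0 := by
  by_contra h
  obtain ⟨x, hx, h1, -⟩ := mem_ofBeta.1
    (YoungDiagram.mem_iff_lt_rowLen.2 (Nat.pos_of_ne_zero h))
  have := card_filter_gt_lt hx
  omega

theorem card_filter_gt_add {X : Finset ℕ} {x : ℕ} (hx : x ∈ X) :
    ((Finset.range x).filter fun y => y ∉ X).card + X.card =
      x + (X.filter fun z => x < z).card + 1 := by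
  have h1 : ((Finset.range x).filter fun y => y ∈ X).card +
      ((Finset.range x).filter fun y => y ∉ X).card = (Finset.range x).card :=
    Finset.card_filter_add_card_filter_not _
  have h2 : (X.filter fun z => x < z).card + (X.filter fun z => ¬ x < z).card = X.card :=
    Finset.card_filter_add_card_filter_not _
  have h3 : (X.filter fun z => ¬ x < z) =
      insert x ((Finset.range x).filter fun y => y ∈ X) := by
    ext y
    simp only [Finset.mem_filter, Finset.mem_insert, Finset.mem_range]
    constructor
    · rintro ⟨h, h'⟩
      rcases eq_or_ne y x with h'' | h''
      · exact .inl h''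
      · exact .inr ⟨by omega, h⟩
    · rintro (rfl | ⟨h, h'⟩)
      · exact ⟨hx, by omega⟩
      · exact ⟨h', by omega⟩
  rw [h3, Finset.card_insert_of_notMem (by simp)] at h2
  rw [Finset.card_range] at h1
  omega

/-- A bead x with a beads above it and b spaces below it is row a of length b, and counting beads
and positions gives b - a - 1 = x - |X|. -/
theorem maya_ofBeta (X : Finset ℕ) : maya (ofBeta X) = beads X X.card := by
  ext z
  rw [mem_maya, mem_beads]
  constructor
  · rintro ⟨i, rfl⟩
    by_cases hi : i < X.card
    · obtain ⟨x, hx, rfl⟩ := exists_card_filter_gt_eq hi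
      refine .inr ⟨x, hx, ?_⟩
      rw [rowLen_ofBeta hx]
      have := card_filter_gt_add hx
      omega
    · rw [rowLen_ofBeta_of_card_le (not_lt.1 hi)]
      left
      omega
  · rintro (h | ⟨x, hx, h⟩)
    · refine ⟨(-z - 1).toNat, ?_⟩
      rw [rowLen_ofBeta_of_card_le (by omega)]
      omega
    · refine ⟨(X.filter fun z => x < z).card, ?_⟩
      rw [rowLen_ofBeta hx]
      have := card_filter_gt_add hx
      omega

theorem ofBeta_betaSet (lam : YoungDiagram) {k : ℕ} (hk : lam.colLen 0 ≤ k) :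
    ofBeta (betaSet lam k) = lam :=
  maya_injective <| by rw [maya_ofBeta, card_betaSet, maya_eq_beads_betaSet lam hk]

theorem maya_bot : maya ⊥ = Set.Iio 0 := by
  have h (i : ℕ) : (⊥ : YoungDiagram).rowLen i = 0 := by
    by_contra h
    exact YoungDiagram.notMem_bot _ (YoungDiagram.mem_iff_lt_rowLen.2 (Nat.pos_of_ne_zero h))
  ext z
  simp only [mem_maya, h, Set.mem_Iio]
  exact ⟨by rintro ⟨i, rfl⟩; omega, fun hz => ⟨(-z - 1).toNat, by omega⟩⟩

/-! ### Duality and diagonal hooks -/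

/-- A common value would force row i and column j to have lengths summing to i + j + 1. The sum is
at least i + j + 2 if (i, j) is a cell, and at most i + j otherwise. -/
theorem mem_maya_transpose {lam : YoungDiagram} {z : ℤ} :
    z ∈ maya lam.transpose ↔ -1 - z ∉ maya lam := by
  simp only [mem_maya, YoungDiagram.rowLen_transpose]
  constructor
  · rintro ⟨j, hj⟩ ⟨i, hi⟩
    have h : j < lam.rowLen i ↔ i < lam.colLen j := by
      rw [← YoungDiagram.mem_iff_lt_rowLen, YoungDiagram.mem_iff_lt_colLen]
    omega
  · intro h
    have hex : ∃ i : ℕ, (lam.rowLen i : ℤ) - i - 1 ≤ -1 - z := by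
      refine ⟨lam.rowLen 0 + z.toNat, ?_⟩
      have := lam.rowLen_anti 0 (lam.rowLen 0 + z.toNat) (by omega)
      push_cast
      omega
    classical
    obtain ⟨i, hi, hmin⟩ : ∃ i : ℕ, (lam.rowLen i : ℤ) - i - 1 ≤ -1 - z ∧
        ∀ m < i, ¬ (lam.rowLen m : ℤ) - m - 1 ≤ -1 - z :=
      ⟨Nat.find hex, Nat.find_spec hex, fun m hm => Nat.find_min hex hm⟩
    have hne : (lam.rowLen i : ℤ) - i - 1 ≠ -1 - z := fun h' => h ⟨i, h'⟩
    -- Column j = i - 1 - z has length exactly i: row i does not reach it, while row i - 1, if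
    -- present, does by minimality of i.
    obtain ⟨j, hj⟩ : ∃ j : ℕ, (j : ℤ) = i - 1 - z := ⟨(i - 1 - z).toNat, by omega⟩
    refine ⟨j, ?_⟩
    have h1 : ¬ i < lam.colLen j := by
      rw [← YoungDiagram.mem_iff_lt_colLen, YoungDiagram.mem_iff_lt_rowLen]
      omega
    have h2 : ¬ lam.colLen j < i := by
      intro hlt
      have h3 : ¬ i - 1 < lam.colLen j := by omega
      rw [← YoungDiagram.mem_iff_lt_colLen, YoungDiagram.mem_iff_lt_rowLen] at h3
      have := hmin (i - 1) (by omega)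
      omega
    omega

theorem isSymmetric_iff {lam : YoungDiagram} :
    IsSymmetric lam ↔ ∀ z, z ∈ maya lam ↔ -1 - z ∉ maya lam := by
  rw [IsSymmetric, ← maya_injective.eq_iff, Set.ext_iff]
  exact forall_congr' fun z => by rw [mem_maya_transpose]; exact iff_comm

theorem mem_D {lam : YoungDiagram} {a b : ℕ} :
    (a, b) ∈ D lam ↔ ∃ i : ℕ, (lam.colLen i : ℤ) - i - 1 = a ∧ (lam.rowLen i : ℤ) - i - 1 = b := by
  simp only [D, Finset.mem_image, Finset.mem_filter, YoungDiagram.mem_cells, Prod.exists,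
    Prod.mk.injEq]
  constructor
  · rintro ⟨i, j, ⟨h, rfl⟩, h1, h2⟩
    have := YoungDiagram.mem_iff_lt_rowLen.1 h
    have := YoungDiagram.mem_iff_lt_colLen.1 h
    exact ⟨i, by omega, by omega⟩
  · rintro ⟨i, h1, h2⟩
    exact ⟨i, i, ⟨YoungDiagram.mem_iff_lt_rowLen.2 (by omega), rfl⟩, by omega, by omega⟩

theorem mem_DR {lam : YoungDiagram} {b : ℕ} : b ∈ DR lam ↔ (b : ℤ) ∈ maya lam := by
  simp only [DR, Finset.mem_image, Prod.exists, exists_eq_right, mem_D, mem_maya]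
  constructor
  · rintro ⟨a, i, -, h⟩
    exact ⟨i, h⟩
  · rintro ⟨i, h⟩
    have hi : i < lam.colLen i := by
      rw [← YoungDiagram.mem_iff_lt_colLen, YoungDiagram.mem_iff_lt_rowLen]
      omega
    exact ⟨lam.colLen i - i - 1, i, by omega, h⟩

theorem IsSymmetric.colLen_eq {lam : YoungDiagram} (h : IsSymmetric lam) (i : ℕ) :
    lam.colLen i = lam.rowLen i := by
  rw [← YoungDiagram.rowLen_transpose, h]

theorem IsSymmetric.mem_D {lam : YoungDiagram} (h : IsSymmetric lam) {a b : ℕ} :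
    (a, b) ∈ D lam ↔ a = b ∧ b ∈ DR lam := by
  rw [DiagonalHooks.mem_D, mem_DR, mem_maya]
  simp only [h.colLen_eq]
  constructor
  · rintro ⟨i, h1, h2⟩
    exact ⟨by omega, i, h2⟩
  · rintro ⟨rfl, i, h2⟩
    exact ⟨i, h2, h2⟩

theorem IsSymmetric.DL_eq {lam : YoungDiagram} (h : IsSymmetric lam) : DL lam = DR lam := by
  ext a
  rw [DL, Finset.mem_image]
  constructor
  · rintro ⟨⟨a, b⟩, hab, rfl⟩
    obtain ⟨rfl, hb⟩ := h.mem_D.1 hab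
    exact hb
  · exact fun ha => ⟨(a, a), h.mem_D.2 ⟨rfl, ha⟩, rfl⟩

/-! ### Runners of the abacus -/

theorem mem_runner {p γ j : ℕ} {X : Finset ℕ} (hγ : γ < p) :
    j ∈ runner p X γ ↔ γ + j * p ∈ X := by
  simp only [runner, Finset.mem_image, Finset.mem_filter]
  constructor
  · rintro ⟨x, ⟨hx, rfl⟩, rfl⟩
    rwa [Nat.mod_add_div']
  · intro h
    refine ⟨_, ⟨h, ?_⟩, ?_⟩
    · rw [Nat.add_mul_mod_self_right, Nat.mod_eq_of_lt hγ]
    · rw [Nat.add_mul_div_right _ _ (by omega), Nat.div_eq_of_lt hγ, zero_add]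

theorem add_mul_neg_iff {p γ : ℕ} (hγ : γ < p) (j : ℤ) : (γ : ℤ) + j * p < 0 ↔ j < 0 := by
  constructor
  · intro h
    by_contra hj
    have : 0 ≤ j * (p : ℤ) := mul_nonneg (not_lt.1 hj) (by omega)
    omega
  · intro h
    have : (j + 1) * (p : ℤ) ≤ 0 := mul_nonpos_of_nonpos_of_nonneg (by omega) (by omega)
    have : (j + 1) * (p : ℤ) = j * p + p := by ring
    omega

/-- With pk beads, the shift by pk preserves residues and becomes a shift by k on every runner. -/
theorem mayaRunner_eq_beads {p γ k : ℕ} (lam : YoungDiagram) (hγ : γ < p)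
    (hk : lam.colLen 0 ≤ p * k) :
    mayaRunner p lam γ = beads (runner p (betaSet lam (p * k)) γ) k := by
  ext j
  rw [mem_mayaRunner, maya_eq_beads_betaSet lam hk, mem_beads, mem_beads]
  have h : (γ : ℤ) + j * p + (p * k : ℕ) = γ + (j + k) * p := by push_cast; ring
  rw [h, add_mul_neg_iff hγ]
  refine or_congr_right ⟨?_, ?_⟩
  · rintro ⟨x, hx, hjx⟩
    have hnn : 0 ≤ j + k := by
      rw [← not_lt, ← add_mul_neg_iff hγ, hjx]
      omega
    lift j + k to ℕ using hnn with m
    refine ⟨m, (mem_runner hγ).2 ?_, rfl⟩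
    rwa [show γ + m * p = x by exact_mod_cast hjx]
  · rintro ⟨m, hm, hjm⟩
    exact ⟨_, (mem_runner hγ).1 hm, by rw [hjm]; push_cast; rfl⟩

/-! ### Charge -/

theorem beads_inter_Ici (X : Finset ℕ) (k : ℕ) :
    beads X k ∩ Set.Ici 0 =
      (((X.filter fun x => k ≤ x).image fun x : ℕ => (x : ℤ) - k : Finset ℤ) : Set ℤ) := by
  ext z
  simp only [Set.mem_inter_iff, mem_beads, Set.mem_Ici, Finset.coe_image, Set.mem_image,
    Finset.mem_coe, Finset.mem_filter]
  constructor
  · rintro ⟨h | ⟨x, hx, h⟩, hz⟩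
    · omega
    · exact ⟨x, ⟨hx, by omega⟩, by omega⟩
  · rintro ⟨x, ⟨hx, hk⟩, rfl⟩
    exact ⟨.inr ⟨x, hx, by omega⟩, by omega⟩

theorem Iio_diff_beads (X : Finset ℕ) (k : ℕ) :
    Set.Iio 0 \ beads X k =
      ((((Finset.range k).filter fun x => x ∉ X).image fun x : ℕ => (x : ℤ) - k : Finset ℤ) :
        Set ℤ) := by
  ext z
  simp only [Set.mem_sdiff, mem_beads, Set.mem_Iio, Finset.coe_image, Set.mem_image,
    Finset.mem_coe, Finset.mem_filter, Finset.mem_range]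
  constructor
  · rintro ⟨hz, h⟩
    push Not at h
    refine ⟨(z + k).toNat, ⟨by omega, fun hx => h.2 _ hx (by omega)⟩, by omega⟩
  · rintro ⟨x, ⟨hk, hx⟩, rfl⟩
    refine ⟨by omega, ?_⟩
    rintro (h | ⟨y, hy, h⟩)
    · omega
    · obtain rfl : x = y := by omega
      exact hx hy

theorem charge_beads (X : Finset ℕ) (k : ℕ) : charge (beads X k) = (X.card : ℤ) - k := by
  have hinj : Function.Injective fun x : ℕ => (x : ℤ) - k := fun x y h => by
    simp only at h
    omega
  rw [charge, beads_inter_Ici, Iio_diff_beads, Set.ncard_coe_finset, Set.ncard_coe_finset,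
    Finset.card_image_of_injective _ hinj, Finset.card_image_of_injective _ hinj]
  have h1 : (X.filter fun x => k ≤ x).card + (X.filter fun x => ¬ k ≤ x).card = X.card :=
    Finset.card_filter_add_card_filter_not _
  have h2 : ((Finset.range k).filter fun x => x ∈ X).card +
      ((Finset.range k).filter fun x => x ∉ X).card = (Finset.range k).card :=
    Finset.card_filter_add_card_filter_not _
  have h3 : (X.filter fun x => ¬ k ≤ x) = (Finset.range k).filter fun x => x ∈ X := by
    ext x
    simp [and_comm]
  rw [Finset.card_range] at h2
  rw [h3] at h1
  omega

/-- Only the step from 0 to -1 changes the counts: it removes a nonnegative bead and fills a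
negative space, so both drop by one. Finiteness matters there because `ncard` of an infinite set is
0. -/
theorem charge_move {N : Set ℤ} (hN : (N ∩ Set.Ici 0).Finite) (hN' : (Set.Iio 0 \ N).Finite)
    {j : ℤ} (hj : j ∈ N) (hj' : j - 1 ∉ N) :
    charge (insert (j - 1) (N \ {j})) = charge N := by
  rcases lt_trichotomy j 0 with h | rfl | h
  · have h1 : insert (j - 1) (N \ {j}) ∩ Set.Ici 0 = N ∩ Set.Ici 0 := by
      ext z
      simp only [Set.mem_inter_iff, Set.mem_insert_iff, Set.mem_sdiff, Set.mem_singleton_iff,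
        Set.mem_Ici]
      constructor
      · rintro ⟨rfl | h2, h3⟩
        · omega
        · exact ⟨h2.1, h3⟩
      · exact fun h2 => ⟨.inr ⟨h2.1, by omega⟩, h2.2⟩
    have h2 : Set.Iio 0 \ insert (j - 1) (N \ {j}) =
        insert j ((Set.Iio 0 \ N) \ {j - 1}) := by
      ext z
      simp only [Set.mem_insert_iff, Set.mem_sdiff, Set.mem_singleton_iff, Set.mem_Iio]
      rcases eq_or_ne z j with rfl | h3
      · simp only [h, true_or, iff_true, true_and]
        rintro (h4 | h4)
        · omega
        · exact h4.2 trivial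
      · tauto
    have h3 : j - 1 ∈ Set.Iio 0 \ N := ⟨by simp only [Set.mem_Iio]; omega, hj'⟩
    rw [charge, charge, h1, h2, Set.ncard_exchange (fun h4 => h4.2 hj) h3]
  · have h1 : insert (0 - 1) (N \ {0}) ∩ Set.Ici 0 = (N ∩ Set.Ici 0) \ {0} := by
      ext z
      simp only [Set.mem_inter_iff, Set.mem_insert_iff, Set.mem_sdiff, Set.mem_singleton_iff,
        Set.mem_Ici]
      constructor
      · rintro ⟨rfl | h2, h3⟩
        · omega
        · exact ⟨⟨h2.1, h3⟩, h2.2⟩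
      · exact fun h2 => ⟨.inr ⟨h2.1.1, h2.2⟩, h2.1.2⟩
    have h2 : Set.Iio 0 \ insert (0 - 1) (N \ {0}) = (Set.Iio 0 \ N) \ {0 - 1} := by
      ext z
      simp only [Set.mem_insert_iff, Set.mem_sdiff, Set.mem_singleton_iff, Set.mem_Iio]
      rcases eq_or_ne z 0 with rfl | h3
      · simp
      · tauto
    have h3 := Set.ncard_sdiff_singleton_add_one (s := N ∩ Set.Ici 0) (a := 0) ⟨hj, by simp⟩ hN
    have h4 := Set.ncard_sdiff_singleton_add_one (s := Set.Iio 0 \ N) (a := 0 - 1)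
      ⟨by simp, hj'⟩ hN'
    rw [charge, charge, h1, h2]
    omega
  · have h1 : insert (j - 1) (N \ {j}) ∩ Set.Ici 0 =
        insert (j - 1) ((N ∩ Set.Ici 0) \ {j}) := by
      ext z
      simp only [Set.mem_inter_iff, Set.mem_insert_iff, Set.mem_sdiff, Set.mem_singleton_iff,
        Set.mem_Ici]
      constructor
      · rintro ⟨h2 | h2, h3⟩
        · exact .inl h2
        · exact .inr ⟨⟨h2.1, h3⟩, h2.2⟩
      · rintro (h2 | h2)
        · exact ⟨.inl h2, by omega⟩
        · exact ⟨.inr ⟨h2.1.1, h2.2⟩, h2.1.2⟩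
    have h2 : Set.Iio 0 \ insert (j - 1) (N \ {j}) = Set.Iio 0 \ N := by
      ext z
      simp only [Set.mem_insert_iff, Set.mem_sdiff, Set.mem_singleton_iff, Set.mem_Iio]
      constructor
      · rintro ⟨h3, h4⟩
        exact ⟨h3, fun h5 => h4 (.inr ⟨h5, by omega⟩)⟩
      · rintro ⟨h3, h4⟩
        refine ⟨h3, ?_⟩
        rintro (h5 | h5)
        · omega
        · exact h4 h5.1
    have h3 : j ∈ N ∩ Set.Ici 0 := ⟨hj, h.le⟩
    rw [charge, charge, h1, h2, Set.ncard_exchange (fun h4 => hj' h4.1) h3]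

theorem charge_Iio (c : ℤ) : charge (Set.Iio c) = c := by
  -- Shifting by |c| makes the endpoint c + |c| nonnegative, as a β-set requires.
  have h : Set.Iio c = beads (Finset.range (c + c.natAbs).toNat) c.natAbs := by
    ext z
    simp only [Set.mem_Iio, mem_beads, Finset.mem_range]
    constructor
    · intro hz
      by_cases h : z + c.natAbs < 0
      · exact .inl h
      · exact .inr ⟨(z + c.natAbs).toNat, by omega, by omega⟩
    · rintro (h | ⟨x, hx, h⟩) <;> omega
  rw [h, charge_beads, Finset.card_range]
  omega

/-- The reflection exchanges nonnegative beads with negative spaces. -/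
theorem charge_reflect (N : Set ℤ) : charge {z | -1 - z ∉ N} = -charge N := by
  have hinj : Function.Injective fun z : ℤ => -1 - z := fun x y h => by
    simp only at h
    omega
  have h1 : {z | -1 - z ∉ N} ∩ Set.Ici 0 = (fun z : ℤ => -1 - z) '' (Set.Iio 0 \ N) := by
    ext z
    simp only [Set.mem_inter_iff, Set.mem_ofPred_eq, Set.mem_Ici, Set.mem_image, Set.mem_sdiff,
      Set.mem_Iio]
    constructor
    · exact fun h => ⟨-1 - z, ⟨by omega, h.1⟩, by omega⟩
    · rintro ⟨w, ⟨hw, hw'⟩, rfl⟩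
      exact ⟨by rwa [sub_sub_cancel], by omega⟩
  have h2 : Set.Iio 0 \ {z | -1 - z ∉ N} = (fun z : ℤ => -1 - z) '' (N ∩ Set.Ici 0) := by
    ext z
    simp only [Set.mem_inter_iff, Set.mem_ofPred_eq, Set.mem_Ici, Set.mem_image, Set.mem_sdiff,
      Set.mem_Iio, not_not]
    constructor
    · exact fun h => ⟨-1 - z, ⟨h.2, by omega⟩, by omega⟩
    · rintro ⟨w, ⟨hw, hw'⟩, rfl⟩
      exact ⟨by omega, by rwa [sub_sub_cancel]⟩
  rw [charge, charge, h1, h2, Set.ncard_image_of_injective _ hinj,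
    Set.ncard_image_of_injective _ hinj]
  ring

/-! ### Hook removal, cores and quotients -/

theorem finite_mayaRunner {p γ : ℕ} (lam : YoungDiagram) (hγ : γ < p) :
    (mayaRunner p lam γ ∩ Set.Ici 0).Finite ∧ (Set.Iio 0 \ mayaRunner p lam γ).Finite := by
  rw [mayaRunner_eq_beads lam hγ (Nat.le_mul_of_pos_left (lam.colLen 0) (by omega)),
    beads_inter_Ici, Iio_diff_beads]
  exact ⟨Finset.finite_toSet _, Finset.finite_toSet _⟩

theorem RemovesPHook.exists_maya_eq {p : ℕ} {lam mu : YoungDiagram} (h : RemovesPHook p lam mu) :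
    ∃ z ∈ maya lam, z - p ∉ maya lam ∧ maya mu = insert (z - p) (maya lam \ {z}) := by
  obtain ⟨X, x, rfl, hx, hpx, hxp, rfl⟩ := h
  have hcard : (insert (x - p) (X.erase x)).card = X.card := by
    rw [Finset.card_insert_of_notMem fun h => hxp (Finset.mem_of_mem_erase h),
      Finset.card_erase_add_one hx]
  rw [maya_ofBeta, maya_ofBeta, hcard]
  refine ⟨x - X.card, .inr ⟨x, hx, by omega⟩, ?_, ?_⟩
  · rintro (h | ⟨y, hy, h⟩)
    · omega
    · exact hxp (by rwa [show x - p = y by omega])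
  · ext z
    simp only [mem_beads, Set.mem_insert_iff, Set.mem_sdiff, Set.mem_singleton_iff,
      Finset.mem_insert, Finset.mem_erase]
    constructor
    · rintro (h | ⟨y, rfl | ⟨hyx, hy⟩, h⟩)
      · exact .inr ⟨.inl h, by omega⟩
      · left
        omega
      · exact .inr ⟨.inr ⟨y, hy, h⟩, by omega⟩
    · rintro (h | ⟨h | ⟨y, hy, h⟩, h'⟩)
      · exact .inr ⟨x - p, .inl rfl, by omega⟩
      · exact .inl h
      · exact .inr ⟨y, .inr ⟨by omega, hy⟩, h⟩

theorem RemovesPHook.charge_eq {p γ : ℕ} {lam mu : YoungDiagram} (h : RemovesPHook p lam mu)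
    (hγ : γ < p) : charge (mayaRunner p mu γ) = charge (mayaRunner p lam γ) := by
  obtain ⟨z, hz, hzp, hmu⟩ := h.exists_maya_eq
  have hp : p ≠ 0 := by omega
  by_cases hmod : ∃ j : ℤ, (γ : ℤ) + j * p = z
  · obtain ⟨j, rfl⟩ := hmod
    have hj : (γ : ℤ) + j * p - p = γ + (j - 1) * p := by ring
    rw [hj] at hzp hmu
    have : mayaRunner p mu γ = insert (j - 1) (mayaRunner p lam γ \ {j}) := by
      ext i
      simp [mem_mayaRunner, hmu, hp]
    rw [this]
    exact charge_move (finite_mayaRunner lam hγ).1 (finite_mayaRunner lam hγ).2 hz hzp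
  · push Not at hmod
    congr 1
    ext i
    rw [mem_mayaRunner, mem_mayaRunner, hmu, Set.mem_insert_iff, Set.mem_sdiff,
      Set.mem_singleton_iff]
    have h1 := hmod i
    have h2 : (γ : ℤ) + i * p ≠ z - p := fun h => hmod (i + 1) (by linear_combination h)
    tauto

theorem IsPCoreOf.charge_eq {p γ : ℕ} {core lam : YoungDiagram} (h : IsPCoreOf p core lam)
    (hγ : γ < p) : charge (mayaRunner p core γ) = charge (mayaRunner p lam γ) := by
  obtain ⟨h, -⟩ := h
  induction h with
  | refl => rfl
  | tail _ h ih => exact (h.charge_eq hγ).trans ih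

/-- The two finiteness conditions make N bounded above and nonempty; closed under going down, it is
then a ray, and the charge is its endpoint. -/
theorem eq_Iio_charge {N : Set ℤ} (hN : (N ∩ Set.Ici 0).Finite) (hN' : (Set.Iio 0 \ N).Finite)
    (hdown : ∀ j ∈ N, j - 1 ∈ N) : N = Set.Iio (charge N) := by
  have hbdd : ∃ b : ℤ, ∀ z, z ∈ N → z ≤ b := by
    obtain ⟨b, hb⟩ := hN.bddAbove
    refine ⟨max b 0, fun z hz => ?_⟩
    rcases le_total 0 z with h | h
    · exact le_max_of_le_left (hb ⟨hz, h⟩)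
    · exact le_max_of_le_right h
  have hne : ∃ z, z ∈ N := by
    by_contra h
    push Not at h
    refine Set.Iio_infinite (0 : ℤ) (hN'.subset fun z hz => ⟨hz, h z⟩)
  obtain ⟨u, hu, hmax⟩ := Int.exists_greatest_of_bdd hbdd hne
  have hsub (n : ℕ) : u - n ∈ N := by
    induction n with
    | zero => simpa using hu
    | succ n ih =>
      have := hdown _ ih
      rwa [show u - n - 1 = u - (n + 1 : ℕ) by push_cast; ring] at this
  have h : N = Set.Iio (u + 1) := by
    ext z
    rw [Set.mem_Iio]
    constructor
    · intro hz
      have := hmax z hz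
      omega
    · intro hz
      have := hsub (u - z).toNat
      rwa [show u - ((u - z).toNat : ℤ) = z by omega] at this
  rw [h, charge_Iio]

/-- A space directly below a bead on a runner would allow another p-hook to be removed from the
core. -/
theorem IsPCoreOf.mayaRunner_eq {p γ : ℕ} {core lam : YoungDiagram} (h : IsPCoreOf p core lam)
    (hγ : γ < p) : mayaRunner p core γ = Set.Iio (charge (mayaRunner p lam γ)) := by
  rw [← h.charge_eq hγ]
  refine eq_Iio_charge (finite_mayaRunner core hγ).1 (finite_mayaRunner core hγ).2 fun j hj => ?_
  by_contra hj'
  rw [mem_mayaRunner] at hj hj'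
  rw [show (γ : ℤ) + (j - 1) * p = γ + j * p - p by ring] at hj'
  generalize (γ : ℤ) + j * p = z at hj hj'
  -- The summand p + |z| ensures z + k ≥ p, so that the bead and its target both lie in the β-set's
  -- range.
  have hk : core.colLen 0 ≤ core.colLen 0 + p + z.natAbs := by omega
  rw [maya_eq_beads_betaSet core hk] at hj hj'
  rw [mem_beads] at hj hj'
  rcases hj with hj | ⟨x, hx, hj⟩
  · omega
  · exact h.2 _ ⟨_, x, ofBeta_betaSet core hk, hx, by omega,
      fun hxp => hj' (.inr ⟨_, hxp, by omega⟩), rfl⟩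

/-- `ofBeta` recentres a runner by its own number of beads |X_γ| rather than by the common k; the
discrepancy |X_γ| - k is the charge. -/
theorem mem_maya_pQuotient {p : ℕ} {lam : YoungDiagram} (γ : Fin p) {z : ℤ} :
    z ∈ maya (pQuotient p lam γ) ↔
      z + charge (mayaRunner p lam γ) ∈ mayaRunner p lam γ := by
  rw [mayaRunner_eq_beads lam γ.2 (Nat.le_mul_of_pos_left (lam.colLen 0) γ.pos),
    charge_beads, pQuotient, maya_ofBeta, mem_beads, mem_beads]
  rw [add_assoc z, sub_add_cancel]

/-! ### Symmetry between the residues γ and p - 1 - γ -/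

theorem mem_mayaRunner_reflect {p γ : ℕ} {lam : YoungDiagram} (h : IsSymmetric lam) (hγ : γ < p)
    {z : ℤ} : z ∈ mayaRunner p lam (p - 1 - γ) ↔ -1 - z ∉ mayaRunner p lam γ := by
  rw [mem_mayaRunner, mem_mayaRunner, isSymmetric_iff.1 h]
  have : -1 - (((p - 1 - γ : ℕ) : ℤ) + z * p) = γ + (-1 - z) * p := by
    rw [show ((p - 1 - γ : ℕ) : ℤ) = p - 1 - γ by omega]
    ring
  rw [this]

theorem IsSymmetric.charge_reflect {p γ : ℕ} {lam : YoungDiagram} (h : IsSymmetric lam)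
    (hγ : γ < p) :
    charge (mayaRunner p lam (p - 1 - γ)) = -charge (mayaRunner p lam γ) := by
  rw [← DiagonalHooks.charge_reflect]
  congr 1
  ext z
  exact mem_mayaRunner_reflect h hγ

theorem exists_eq_add_mul {p : ℕ} (hp : 0 < p) (z : ℤ) :
    ∃ γ < p, ∃ j : ℤ, z = (γ : ℤ) + j * p := by
  have hp' : (0 : ℤ) < p := by omega
  have h1 := Int.emod_nonneg z hp'.ne'
  have h2 := Int.emod_lt_of_pos z hp'
  refine ⟨(z % p).toNat, by omega, z / p, ?_⟩
  rw [Int.toNat_of_nonneg h1, mul_comm, Int.emod_add_mul_ediv]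

theorem IsPCoreOf.isSymmetric {p : ℕ} (hp : 0 < p) {core lam : YoungDiagram}
    (h : IsPCoreOf p core lam) (hlam : IsSymmetric lam) : IsSymmetric core := by
  rw [isSymmetric_iff]
  intro z
  obtain ⟨γ, hγ, j, rfl⟩ := exists_eq_add_mul hp z
  have : -1 - ((γ : ℤ) + j * p) = (p - 1 - γ : ℕ) + (-1 - j) * p := by
    rw [show ((p - 1 - γ : ℕ) : ℤ) = p - 1 - γ by omega]
    ring
  rw [this, ← mem_mayaRunner, ← mem_mayaRunner, h.mayaRunner_eq hγ,
    h.mayaRunner_eq (by omega : p - 1 - γ < p), hlam.charge_reflect hγ, Set.mem_Iio, Set.mem_Iio]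
  omega

/-! ### Diagonal hooks in terms of runners and charges -/

theorem add_mul_mem_DR {p γ m : ℕ} {lam : YoungDiagram} :
    γ + m * p ∈ DR lam ↔ (m : ℤ) ∈ mayaRunner p lam γ := by
  rw [mem_DR, mem_mayaRunner]
  push_cast
  rfl

theorem mem_quotR {p γ m : ℕ} {lam : YoungDiagram} (hγ : γ < p) :
    m ∈ quotR p lam γ ↔ (m : ℤ) ∈ mayaRunner p lam γ :=
  (mem_runner hγ).trans add_mul_mem_DR

theorem IsSymmetric.mem_quotL {p γ m : ℕ} {lam : YoungDiagram} (h : IsSymmetric lam)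
    (hγ : γ < p) : m ∈ quotL p lam γ ↔ (m : ℤ) ∈ mayaRunner p lam (p - 1 - γ) := by
  rw [quotL, h.DL_eq]
  exact mem_quotR (by omega)

/-- The core is symmetric, so every diagonal hook counts, and the nonnegative part of the ray below
c is {0, …, c - 1}; `toNat` returns 0 for negative c. -/
theorem d0_eq {p γ : ℕ} {core lam : YoungDiagram} (h : IsPCoreOf p core lam)
    (hlam : IsSymmetric lam) (hγ : γ < p) :
    d0 p core γ = (charge (mayaRunner p lam γ)).toNat := by
  have hcore : IsSymmetric core := h.isSymmetric (by omega) hlam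
  have hset : residuePart p core γ =
      (Finset.range (charge (mayaRunner p lam γ)).toNat).image
        fun m => (γ + m * p, γ + m * p) := by
    ext ⟨a, b⟩
    simp only [residuePart, Finset.mem_filter, hcore.mem_D, Finset.mem_image, Finset.mem_range,
      Prod.mk.injEq]
    constructor
    · rintro ⟨⟨rfl, ha⟩, -, rfl⟩
      rw [← Nat.mod_add_div' a p, add_mul_mem_DR, h.mayaRunner_eq hγ, Set.mem_Iio] at ha
      exact ⟨a / p, by omega, Nat.mod_add_div' a p, Nat.mod_add_div' a p⟩
    · rintro ⟨m, hm, rfl, rfl⟩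
      refine ⟨⟨rfl, ?_⟩, rfl, by rw [Nat.add_mul_mod_self_right, Nat.mod_eq_of_lt hγ]⟩
      rw [add_mul_mem_DR, h.mayaRunner_eq hγ, Set.mem_Iio]
      omega
  rw [d0, hset, Finset.card_image_of_injective, Finset.card_range]
  intro m n hmn
  simp only [Prod.mk.injEq, and_self] at hmn
  exact Nat.eq_of_mul_eq_mul_right (by omega) (Nat.add_left_cancel hmn)

/-- An empty core forces all charges of `bar` to vanish, so its runners are the Maya diagrams of the
common quotient without any shift. -/
theorem IsBarOf.mem_mayaRunner_iff {p γ : ℕ} {bar lam : YoungDiagram} (h : IsBarOf p bar lam)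
    (hγ : γ < p) {z : ℤ} :
    z ∈ mayaRunner p bar γ ↔ z + charge (mayaRunner p lam γ) ∈ mayaRunner p lam γ := by
  have hbot : mayaRunner p ⊥ γ = Set.Iio 0 := by
    ext j
    rw [mem_mayaRunner, maya_bot, Set.mem_Iio, Set.mem_Iio, add_mul_neg_iff hγ]
  have hcharge : charge (mayaRunner p bar γ) = 0 := by
    rw [← h.core_empty.charge_eq hγ, hbot, charge_Iio]
  have := mem_maya_pQuotient (lam := bar) ⟨γ, hγ⟩ (z := z)
  rw [h.quotient_eq, mem_maya_pQuotient] at this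
  simpa [hcharge] using this.symm

theorem IsBarOf.add_mul_mem_DR_iff {p γ m : ℕ} {bar lam : YoungDiagram} (h : IsBarOf p bar lam)
    (hγ : γ < p) :
    γ + m * p ∈ DR lam ↔ (m : ℤ) - charge (mayaRunner p lam γ) ∈ mayaRunner p bar γ := by
  rw [add_mul_mem_DR, h.mem_mayaRunner_iff hγ, sub_add_cancel]

/-- A positive charge puts γ in Ω'; a negative one makes the charge at p - 1 - γ positive and puts γ
in (Ω')*. -/
theorem mem_Omega'' {p γ : ℕ} {core lam : YoungDiagram} (h : IsPCoreOf p core lam)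
    (hlam : IsSymmetric lam) :
    γ ∈ Omega'' p core ↔ γ < p ∧ charge (mayaRunner p lam γ) = 0 := by
  simp only [Omega'', Omega'Star, Omega', Finset.mem_sdiff, Finset.mem_union, Finset.mem_image,
    Finset.mem_filter, Finset.mem_range]
  refine and_congr_right fun hγ => ?_
  have hrefl := hlam.charge_reflect hγ
  constructor
  · intro hn
    by_contra h0
    rcases lt_or_gt_of_ne h0 with h1 | h1
    · refine hn (.inr ⟨p - 1 - γ, ⟨by omega, ?_⟩, by omega⟩)
      rw [d0_eq h hlam (by omega)]
      omega
    · refine hn (.inl ⟨hγ, ?_⟩)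
      rw [d0_eq h hlam hγ]
      omega
  · rintro h0 (⟨-, h1⟩ | ⟨δ, ⟨hδ, h1⟩, rfl⟩)
    · rw [d0_eq h hlam hγ] at h1
      omega
    · rw [d0_eq h hlam hδ] at h1
      rw [hlam.charge_reflect hδ] at h0
      omega

end DiagonalHooks

/-! ### The decomposition of D(lam)_R -/

theorem proposition8p4 (p : ℕ) (hp : p.Prime) (lam core bar : YoungDiagram)
    (hsymm : DiagonalHooks.IsSymmetric lam)
    (hcore : DiagonalHooks.IsPCoreOf p core lam)
    (hbar : DiagonalHooks.IsBarOf p bar lam) :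
    DiagonalHooks.DR lam =
      DiagonalHooks.O1 p core bar ∪ DiagonalHooks.O2 p core bar ∪
        DiagonalHooks.O3 p core bar ∪ DiagonalHooks.O4 p core bar := by
  open DiagonalHooks in
  have hL {γ s : ℕ} (hγ : γ < p) : s ∈ quotL p bar γ ↔ -1 - (s : ℤ) ∉ mayaRunner p bar γ := by
    rw [hbar.symmetric.mem_quotL hγ, mem_mayaRunner_reflect hbar.symmetric hγ]
  ext b
  simp only [Finset.mem_union]
  constructor
  · intro hb
    obtain ⟨γ, m, hγ, rfl⟩ : ∃ γ m, γ < p ∧ γ + m * p = b :=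
      ⟨b % p, b / p, Nat.mod_lt _ hp.pos, Nat.mod_add_div' b p⟩
    have hrefl := hsymm.charge_reflect hγ
    have hd := d0_eq hcore hsymm hγ
    have hd' := d0_eq hcore hsymm (by omega : p - 1 - γ < p)
    rw [hbar.add_mul_mem_DR_iff hγ] at hb
    rcases lt_trichotomy (charge (mayaRunner p lam γ)) 0 with hc | hc | hc
    · left; right
      simp only [O3, T, Omega', Finset.mem_biUnion, Finset.mem_image, Finset.mem_filter,
        Finset.mem_range]
      -- Here d⁰ at p - 1 - γ equals -c_γ, so t = m + d⁰ is the position m - c_γ.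
      refine ⟨p - 1 - γ, ⟨by omega, by omega⟩, m + d0 p core (p - 1 - γ),
        ⟨?_, by omega⟩, ?_⟩
      · rw [hbar.symmetric.mem_quotL (by omega), show p - 1 - (p - 1 - γ) = γ by omega]
        convert hb using 1
        omega
      · rw [Nat.add_sub_cancel, show p - 1 - (p - 1 - γ) = γ by omega]
    · right
      simp only [O4, Finset.mem_biUnion, Finset.mem_image]
      refine ⟨γ, (mem_Omega'' hcore hsymm).2 ⟨hγ, hc⟩, m, ?_, rfl⟩
      rw [mem_quotR hγ]
      simpa [hc] using hb
    · left; left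
      rcases lt_or_ge m (d0 p core γ) with hm | hm
      · right
        simp only [O2, S, Omega', Finset.mem_biUnion, Finset.mem_image, Finset.mem_filter,
          Finset.mem_range]
        -- The position m - d⁰ is negative; s is its reflection, determined by -1 - s = m - d⁰, and
        -- a bead there means that s is not in D_γ(bar)_L.
        refine ⟨γ, ⟨hγ, by omega⟩, d0 p core γ - m - 1, ⟨by omega, ?_⟩, ?_⟩
        · rw [hL hγ, not_not]
          convert hb using 1
          omega
        · rw [show d0 p core γ - (d0 p core γ - m - 1) - 1 = m by omega]
      · left
        simp only [O1, Omega', Finset.mem_biUnion, Finset.mem_image, Finset.mem_filter,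
          Finset.mem_range]
        refine ⟨γ, ⟨hγ, by omega⟩, m - d0 p core γ, ?_, ?_⟩
        · rw [mem_quotR hγ]
          convert hb using 1
          omega
        · rw [Nat.sub_add_cancel hm]
  · rintro (((hb | hb) | hb) | hb)
    · simp only [O1, Omega', Finset.mem_biUnion, Finset.mem_image, Finset.mem_filter,
        Finset.mem_range] at hb
      obtain ⟨γ, ⟨hγ, hpos⟩, m, hm, rfl⟩ := hb
      rw [d0_eq hcore hsymm hγ] at hpos ⊢
      rw [mem_quotR hγ] at hm
      rw [hbar.add_mul_mem_DR_iff hγ]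
      convert hm using 1
      omega
    · simp only [O2, S, Omega', Finset.mem_biUnion, Finset.mem_image, Finset.mem_filter,
        Finset.mem_range] at hb
      obtain ⟨γ, ⟨hγ, hpos⟩, s, ⟨hs, hsL⟩, rfl⟩ := hb
      rw [hL hγ, not_not] at hsL
      rw [d0_eq hcore hsymm hγ] at hpos hs ⊢
      rw [hbar.add_mul_mem_DR_iff hγ]
      convert hsL using 1
      omega
    · simp only [O3, T, Omega', Finset.mem_biUnion, Finset.mem_image, Finset.mem_filter,
        Finset.mem_range] at hb
      obtain ⟨γ, ⟨hγ, hpos⟩, t, ⟨ht, hle⟩, rfl⟩ := hb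
      rw [hbar.symmetric.mem_quotL hγ] at ht
      rw [d0_eq hcore hsymm hγ] at hpos hle ⊢
      rw [hbar.add_mul_mem_DR_iff (by omega), hsymm.charge_reflect hγ]
      convert ht using 1
      omega
    · simp only [O4, Finset.mem_biUnion, Finset.mem_image] at hb
      obtain ⟨γ, hγ, m, hm, rfl⟩ := hb
      obtain ⟨hγ, hc⟩ := (mem_Omega'' hcore hsymm).1 hγ
      rw [mem_quotR hγ] at hm
      rw [hbar.add_mul_mem_DR_iff hγ, hc, sub_zero]
      exact hm
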